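/- **Lemma (Time Abstracted Observational Bisimulation Game).** Let $A_1,A_2$ be timed automata over the same finite set $Act$ of actions (finitely many locations, clocks and edges; guards and invariants are conjunctions of comparisons $x\smile c$ of a clock with a $c\in\mathbb N$, $\smile\,\in\{\le,<,=,>,\ge\}$). Let $p,q$ be states of the timed transition systems $T(A_1),T(A_2)$, in which a state is a pair (location, valuation of the clocks in $\mathbb R_{\ge 0}$) satisfying the location's invariant, and the transitions are actions $a\in Act$ and delays $d\in\mathbb R_{\ge0}$. *Relation.* A symmetric relation $R$ on the states of a timed transition system is a time abstracted observational bisimulation if, whenever $p_1\,R\,p_2$: (i) if $p_1\xrightarrow{a}p_1'$ with $a\in Act$, then $p_2\xrightarrow{d_1}\xrightarrow{a}\xrightarrow{d_2}p_2'$ with $p_1'\,R\,p_2'$ for some $d_1,d_2\in\mathbb R_{\ge 0}$ and some $p_2'$; (ii) if $p_1\xrightarrow{d}p_1'$ with $d\in\mathbb R_{\ge0}$, then $p_2\xrightarrow{d'}p_2'$ with $p_1'\,R\,p_2'$ for some $d'\in\mathbb R_{\ge0}$ and some $p_2'$. We write $p\sim_o q$ if some such relation on the disjoint union of $T(A_1)$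 and $T(A_2)$ relates $p$ and $q$. Time abstracted bisimilarity $\sim_u$ is defined in the same way, with $p_2\xrightarrow{a}p_2'$ in (i). *Graphs.* Let $Lep=Act\cup\{\varepsilon\}$, where $\varepsilon$ stands for an arbitrary delay $d\ge 0$. A zone valuation graph of a state $p$ of $T(A)$ is a finite graph with edges labelled in $Lep$ and an initial node, from which every node can be reached. Each node $s$ carries a set of locations with a convex zone at each of them, a zone being a finite union of sets defined by finite conjunctions of constraints $x\smile c$ and $x-y\smile c$; $\mathcal G(s)$ denotes the set of states reachable from $p$ whose location and valuation belong to $s$. It is required that $p$ belongs to the initial node; that every state reachable from $p$ belongs to some $\mathcal G(s)$; that any two states in the same $\mathcal G(s)$ are time abstracted bisimilar in $T(A)$; and that $s\xrightarrow{\alpha}s'$ holds exactly if some state in $\mathcal G(s)$ has an $\alpha$-transition to some state in $\mathcal G(s')$. (The graph need not be minimal.) Let $Z_1$ and $Z_2$ be zone valuation graphs of $p$ and of $q$. *Game.* In the game $\Gamma^{Z,\langle a,\ \varepsilon\to a\to\varepsilon\rangle}_{\infty}$, $a\in Lep$, a position is a pair of nodes of $Z_1$ and $Z_2$, starting from the two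 initial nodes. In each of infinitely many rounds the attacker chooses one of the two graphs, freely in every round, and a label $a\in Lep$, and moves along an edge labelled $a$ in this graph; the defender must answer in the other graph by a path whose edges are labelled $\varepsilon, a, \varepsilon$ in this order. The defender loses if at some point no such answer is given, and wins otherwise. Then the defender has a winning strategy in this game if and only if $p\sim_o q$. -/

import Mathlib

open scoped NNReal

universe u v w

/-! ## Timed automata -/

/-- The comparison symbols `≤, <, =, >, ≥`. -/
inductive Cmp
  | le
  | lt
  | eq
  | gt
  | ge

/-- `r.Holds x y` is the comparison `x r y` of real numbers. -/
def Cmp.Holds : Cmp → ℝ → ℝ → Prop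
  | .le, x, y => x ≤ y
  | .lt, x, y => x < y
  | .eq, x, y => x = y
  | .gt, x, y => x > y
  | .ge, x, y => x ≥ y

/-- Clock valuations. -/
abbrev ClockVal (C : Type*) := C → ℝ≥0

/-- Clock constraints: comparisons `x ⌣ c` of a clock with a natural number, closed under
conjunction. `top` is the trivial constraint (an omitted guard or invariant). -/
inductive ClockConstraint (C : Type u) : Type u
  | top
  | atom (x : C) (r : Cmp) (c : ℕ)
  | and (g h : ClockConstraint C)

/-- Satisfaction of a clock constraint by a valuation. -/
def ClockConstraint.Sat {C : Type u} : ClockConstraint C → ClockVal C → Prop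
  | .top, _ => True
  | .atom x r c, ν => r.Holds (ν x) c
  | .and g h, ν => g.Sat ν ∧ h.Sat ν

/-- An edge: source, guard, action, set of reset clocks, target. -/
structure TAEdge (L C Act : Type*) where
  source : L
  guard : ClockConstraint C
  action : Act
  reset : Set C
  target : L

/-- A timed automaton with locations `L`, clocks `C` and actions `Act`. (Finiteness of the three
sets is imposed by `Finite` instances where the automaton is introduced.) -/
structure TimedAutomaton (L C Act : Type*) where
  initial : L
  edges : Set (TAEdge L C Act)
  edges_finite : edges.Finite
  inv : L → ClockConstraint C

/-! ## Timed labelled transition systems -/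

/-- A timed labelled transition system; labels are actions and delays in `ℝ≥0`. -/
structure TLTS (Act State : Type*) where
  act : State → Act → State → Prop
  delay : State → ℝ≥0 → State → Prop

/-- The disjoint union of two TLTSs over the same actions. -/
def TLTS.sum {Act S₁ S₂ : Type*} (T₁ : TLTS Act S₁) (T₂ : TLTS Act S₂) : TLTS Act (S₁ ⊕ S₂) where
  act
    | .inl p, a, .inl p' => T₁.act p a p'
    | .inr q, a, .inr q' => T₂.act q a q'
    | _, _, _ => False
  delay
    | .inl p, d, .inl p' => T₁.delay p d p'
    | .inr q, d, .inr q' => T₂.delay q d q'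
    | _, _, _ => False

/-- `p'` is reachable from `p` by finitely many action and delay transitions. -/
def TLTS.Reachable {Act State : Type*} (T : TLTS Act State) : State → State → Prop :=
  Relation.ReflTransGen fun p p' => (∃ a, T.act p a p') ∨ (∃ d, T.delay p d p')

/-- Time abstracted bisimulation relations on the states of a TLTS. -/
structure TLTS.IsTimeAbstractedBisimulation {Act State : Type*} (T : TLTS Act State)
    (R : State → State → Prop) : Prop where
  symm : ∀ p q, R p q → R q p
  act : ∀ p q, R p q → ∀ a p', T.act p a p' → ∃ q', T.act q a q' ∧ R p' q'
  delay : ∀ p q, R p q → ∀ d p', T.delay p d p' → ∃ d' q', T.delay q d' q' ∧ R p' q'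

/-- Time abstracted bisimilarity `∼ᵤ`, the largest time abstracted bisimulation. -/
def TLTS.TimeAbstractedBisimilar {Act State : Type*} (T : TLTS Act State) (p q : State) : Prop :=
  ∃ R, T.IsTimeAbstractedBisimulation R ∧ R p q

/-- Time abstracted observational bisimulation relations on the states of a TLTS: an action `a` is
answered by a delay, then `a`, then a delay, and a delay is answered by some delay. -/
structure TLTS.IsTimeAbstractedObsBisimulation {Act State : Type*} (T : TLTS Act State)
    (R : State → State → Prop) : Prop where
  symm : ∀ p q, R p q → R q p
  act : ∀ p q, R p q → ∀ a p', T.act p a p' →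
    ∃ d₁ q₁ q₂ d₂ q', T.delay q d₁ q₁ ∧ T.act q₁ a q₂ ∧ T.delay q₂ d₂ q' ∧ R p' q'
  delay : ∀ p q, R p q → ∀ d p', T.delay p d p' → ∃ d' q', T.delay q d' q' ∧ R p' q'

/-- Time abstracted observational bisimilarity `∼ₒ`, the largest such relation. -/
def TLTS.TimeAbstractedObsBisimilar {Act State : Type*} (T : TLTS Act State) (p q : State) : Prop :=
  ∃ R, T.IsTimeAbstractedObsBisimulation R ∧ R p q

namespace TimedAutomaton

variable {L C Act : Type*}

/-- The processes (states) of `T(A)`: a location and a valuation satisfying its invariant. -/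
def Proc (A : TimedAutomaton L C Act) : Type _ :=
  {s : L × ClockVal C // (A.inv s.1).Sat s.2}

/-- The location of a process. -/
def Proc.loc {A : TimedAutomaton L C Act} (p : A.Proc) : L := p.1.1

/-- The valuation of a process. -/
def Proc.val {A : TimedAutomaton L C Act} (p : A.Proc) : ClockVal C := p.1.2

open Classical in
/-- The valuation `ν[r]`, in which the clocks of `r` are set to `0`. -/
noncomputable def resetVal (ν : ClockVal C) (r : Set C) : ClockVal C :=
  fun x => if x ∈ r then 0 else ν x

/-- The timed transition system `T(A)`. Invariants before and after each transition are part of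
the type `A.Proc`. -/
noncomputable def tlts (A : TimedAutomaton L C Act) : TLTS Act A.Proc where
  act p a p' := ∃ e ∈ A.edges, e.source = p.loc ∧ e.action = a ∧ e.target = p'.loc ∧
    e.guard.Sat p.val ∧ p'.val = resetVal p.val e.reset
  delay p d p' := p'.loc = p.loc ∧ p'.val = fun x => p.val x + d

end TimedAutomaton

/-- Time abstracted observational bisimilarity of two processes of two timed automata over the
same actions, that is, of two states of the disjoint union of their transition systems. -/
def TimeAbstractedObsBisimilar {Act L₁ C₁ L₂ C₂ : Type*} {A₁ : TimedAutomaton L₁ C₁ Act}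
    {A₂ : TimedAutomaton L₂ C₂ Act} (p : A₁.Proc) (q : A₂.Proc) : Prop :=
  (A₁.tlts.sum A₂.tlts).TimeAbstractedObsBisimilar (.inl p) (.inr q)

/-! ## Zones and zone valuation graphs -/

/-- The atoms of zone formulas: `x ⌣ c` and the diagonal constraints `x - y ⌣ c`. -/
inductive ZoneAtom (C : Type u) : Type u
  | clock (x : C) (r : Cmp) (c : ℕ)
  | diag (x y : C) (r : Cmp) (c : ℤ)

/-- Satisfaction of an atom by a valuation. -/
def ZoneAtom.Sat {C : Type u} : ZoneAtom C → ClockVal C → Prop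
  | .clock x r c, ν => r.Holds (ν x) c
  | .diag x y r c, ν => r.Holds ((ν x : ℝ) - ν y) c

/-- A zone is a finite union of sets defined by finite conjunctions of atoms. -/
def IsZone {C : Type u} (V : Set (ClockVal C)) : Prop :=
  ∃ F : List (List (ZoneAtom C)), V = {ν | ∃ φ ∈ F, ∀ b ∈ φ, b.Sat ν}

/-- The edge labels `Lep = Act ∪ {ε}` of zone graphs. -/
inductive Lep (Act : Type u) : Type u
  | eps
  | act (a : Act)

/-- A graph with nodes `N` and edges labelled in `Lep`. Each node `s` carries a set of locations
together with the set of valuations it represents at each of them: `zone s l` is empty if `l` is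
not a location of `s`. (A node with a single location `l` and zone `φ` has `zone s l = φ`.) -/
structure ZoneGraph (L C Act N : Type*) where
  zone : N → L → Set (ClockVal C)
  init : N
  step : N → Lep Act → N → Prop

namespace TimedAutomaton

variable {L C Act N : Type*}

/-- The transitions of `T(A)` with the durations of delays hidden: `ε` is any delay `d ≥ 0`. -/
def lepStep (A : TimedAutomaton L C Act) (p : A.Proc) : Lep Act → A.Proc → Prop
  | .eps, p' => ∃ d, A.tlts.delay p d p'
  | .act a, p' => A.tlts.act p a p'

/-- `𝒢(s)`: the processes reachable from `p` whose location and valuation belong to the node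
`s`. -/
def nodeProcs (A : TimedAutomaton L C Act) (p : A.Proc) (Z : ZoneGraph L C Act N) (s : N) :
    Set A.Proc :=
  {q | A.tlts.Reachable p q ∧ q.val ∈ Z.zone s q.loc}

/-- `Z` is a zone valuation graph of the process `p` of the timed automaton `A`. -/
structure IsZoneValuationGraph (A : TimedAutomaton L C Act) (p : A.Proc)
    (Z : ZoneGraph L C Act N) : Prop where
  /-- there are finitely many nodes -/
  finite : Finite N
  /-- nodes are given by zones -/
  isZone : ∀ s l, IsZone (Z.zone s l)
  /-- the zones are convex -/
  convex : ∀ s l, Convex ℝ≥0 (Z.zone s l)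
  /-- the process `p` belongs to the initial node -/
  init_mem : p.val ∈ Z.zone Z.init p.loc
  /-- every process reachable from `p` belongs to a node -/
  cover : ∀ q, A.tlts.Reachable p q → ∃ s, q ∈ A.nodeProcs p Z s
  /-- the edges are the transitions between processes of the nodes -/
  step_iff : ∀ s α s', Z.step s α s' ↔
    ∃ q ∈ A.nodeProcs p Z s, ∃ q' ∈ A.nodeProcs p Z s', A.lepStep q α q'
  /-- every node can be reached from the initial node -/
  connected : ∀ s, Relation.ReflTransGen (fun s s' => ∃ α, Z.step s α s') Z.init s
  /-- processes of the same node are time abstracted bisimilar -/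
  bisimilar : ∀ s, ∀ q ∈ A.nodeProcs p Z s, ∀ q' ∈ A.nodeProcs p Z s,
    A.tlts.TimeAbstractedBisimilar q q'

end TimedAutomaton

/-! ## Games on two graphs -/

/-- `WordPath step w s t`: there is a path from `s` to `t` whose edges are labelled by the word `w`. -/
def WordPath {S Lab : Type*} (step : S → Lab → S → Prop) : List Lab → S → S → Prop
  | [], s, t => s = t
  | α :: w, s, t => ∃ s', step s α s' ∧ WordPath step w s' t

/-- A challenge of the attacker: the choice of a graph, of a label, and of the node of that graph to
move to. -/
inductive Challenge (Lab S₁ S₂ : Type*)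
  | left (α : Lab) (t : S₁)
  | right (α : Lab) (t : S₂)

/-- The game `Γ_∞^{G,⟨w,u⟩}` played on two graphs with unboundedly many rounds and alternations and
no extra condition. In each round the attacker chooses one of the graphs and a label `α` and moves
in that graph along a path labelled `attack α`; the defender has to move in the other graph along
a path labelled `defend α`. -/
structure BisimGame (Lab S₁ S₂ : Type*) where
  step₁ : S₁ → Lab → S₁ → Prop
  step₂ : S₂ → Lab → S₂ → Prop
  attack : Lab → List Lab
  defend : Lab → List Lab
  start : S₁ × S₂

namespace BisimGame

variable {Lab S₁ S₂ : Type*}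

/-- The attacker may play the challenge at the given position. -/
def LegalChallenge (Γ : BisimGame Lab S₁ S₂) (x : S₁ × S₂) : Challenge Lab S₁ S₂ → Prop
  | .left α t => WordPath Γ.step₁ (Γ.attack α) x.1 t
  | .right α t => WordPath Γ.step₂ (Γ.attack α) x.2 t

/-- `y` is a position that the defender may establish in answer to the challenge. -/
def LegalReply (Γ : BisimGame Lab S₁ S₂) (x : S₁ × S₂) :
    Challenge Lab S₁ S₂ → S₁ × S₂ → Prop
  | .left α t, y => y.1 = t ∧ WordPath Γ.step₂ (Γ.defend α) x.2 y.2
  | .right α t, y => y.2 = t ∧ WordPath Γ.step₁ (Γ.defend α) x.1 y.1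

/-- A history: the positions and challenges of the past rounds, the latest first. -/
abbrev History (Lab S₁ S₂ : Type*) := List ((S₁ × S₂) × Challenge Lab S₁ S₂)

/-- A strategy of the defender: the next position, given the history, the current position and the
current challenge. -/
abbrev Strategy (Lab S₁ S₂ : Type*) :=
  History Lab S₁ S₂ → S₁ × S₂ → Challenge Lab S₁ S₂ → S₁ × S₂

/-- The finite plays (history and current position) in which the attacker plays legally and the
defender follows `σ`. -/
inductive Consistent (Γ : BisimGame Lab S₁ S₂) (σ : Strategy Lab S₁ S₂) :
    History Lab S₁ S₂ → S₁ × S₂ → Prop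
  | start : Consistent Γ σ [] Γ.start
  | round (h : History Lab S₁ S₂) (x : S₁ × S₂) (c : Challenge Lab S₁ S₂) :
      Consistent Γ σ h x → Γ.LegalChallenge x c → Consistent Γ σ ((x, c) :: h) (σ h x c)

/-- `σ` wins for the defender: in every play that follows `σ`, every legal challenge that is ever
made is answered legally. -/
def IsWinning (Γ : BisimGame Lab S₁ S₂) (σ : Strategy Lab S₁ S₂) : Prop :=
  ∀ h x c, Γ.Consistent σ h x → Γ.LegalChallenge x c → Γ.LegalReply x c (σ h x c)

/-- The defender has a winning strategy. -/
def DefenderWins (Γ : BisimGame Lab S₁ S₂) : Prop :=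
  ∃ σ, Γ.IsWinning σ

end BisimGame

/-- The time abstracted observational bisimulation game `Γ_∞^{Z,⟨a, ε→a→ε⟩}`, `a ∈ Lep`, played on
two graphs from their initial nodes. -/
def obsGame {Act L₁ C₁ N₁ L₂ C₂ N₂ : Type*} (Z₁ : ZoneGraph L₁ C₁ Act N₁)
    (Z₂ : ZoneGraph L₂ C₂ Act N₂) : BisimGame (Lep Act) N₁ N₂ where
  step₁ := Z₁.step
  step₂ := Z₂.step
  attack α := [α]
  defend α := [.eps, α, .eps]
  start := (Z₁.init, Z₂.init)

/-! ## Every process has a zone valuation graph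

The nodes are given by the clock and diagonal constraints with constants up to the largest constant
of the automaton. -/

namespace TimedAutomaton

/-- The largest constant of a clock constraint. -/
def constraintMax {C : Type u} : ClockConstraint C → ℕ
  | .top => 0
  | .atom _ _ c => c
  | .and g h => max (constraintMax g) (constraintMax h)

/-- The finitely many atoms whose constants are bounded by `M`. -/
def boundedAtoms (C : Type u) (M : ℕ) : Set (ZoneAtom C)
  | .clock _ _ c => c ≤ M
  | .diag _ _ _ c => |c| ≤ M

/-- `ν` and `ν'` satisfy the same bounded atoms. -/
def SameAtoms {C : Type u} (M : ℕ) (ν ν' : ClockVal C) : Prop :=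
  ∀ b ∈ boundedAtoms C M, b.Sat ν ↔ b.Sat ν'

theorem finite_boundedAtoms (C : Type u) [Finite C] (M : ℕ) : (boundedAtoms C M).Finite := by
  have hC : Finite Cmp := by
    refine Finite.of_injective (β := Fin 5) (fun r => match r with
      | .le => 0 | .lt => 1 | .eq => 2 | .gt => 3 | .ge => 4) ?_
    intro r s
    cases r <;> cases s <;> simp
  have h1 : (Set.univ ×ˢ (Set.univ ×ˢ Set.Iic M) : Set (C × Cmp × ℕ)).Finite :=
    Set.finite_univ.prod (Set.finite_univ.prod (Set.finite_Iic M))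
  have h2 : (Set.univ ×ˢ (Set.univ ×ˢ (Set.univ ×ˢ Set.Icc (-(M : ℤ)) M)) :
      Set (C × C × Cmp × ℤ)).Finite :=
    Set.finite_univ.prod (Set.finite_univ.prod (Set.finite_univ.prod (Set.finite_Icc _ _)))
  refine ((h1.image fun t => ZoneAtom.clock t.1 t.2.1 t.2.2).union
    (h2.image fun t => ZoneAtom.diag t.1 t.2.1 t.2.2.1 t.2.2.2)).subset ?_
  rintro (⟨x, r, c⟩ | ⟨x, y, r, c⟩) h
  · exact Or.inl ⟨(x, r, c), ⟨trivial, trivial, h⟩, rfl⟩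
  · exact Or.inr ⟨(x, y, r, c), ⟨trivial, trivial, trivial, abs_le.1 h⟩, rfl⟩

/-- Satisfying the bounded atoms of `ν` is the same as satisfying the same bounded atoms. -/
theorem sameAtoms_of_imp {C : Type u} {M : ℕ} {ν ν' : ClockVal C}
    (h : ∀ b ∈ boundedAtoms C M, b.Sat ν → b.Sat ν') : SameAtoms M ν ν' := by
  have key : ∀ (r : Cmp) (x y c : ℝ), (∀ s : Cmp, s.Holds x c → s.Holds y c) →
      r.Holds y c → r.Holds x c := by
    intro r x y c hs hr
    have h1 := hs .lt
    have h2 := hs .eq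
    have h3 := hs .gt
    rcases lt_trichotomy x c with h | h | h <;> cases r <;> simp_all [Cmp.Holds] <;> grind
  rintro (⟨x, r, c⟩ | ⟨x, y, r, c⟩) hb
  · exact ⟨h _ hb, key r _ _ _ fun s => h (.clock x s c) hb⟩
  · exact ⟨h _ hb, key r _ _ _ fun s => h (.diag x y s c) hb⟩

theorem SameAtoms.symm {C : Type u} {M : ℕ} {ν ν' : ClockVal C} (h : SameAtoms M ν ν') :
    SameAtoms M ν' ν := fun b hb => (h b hb).symm

theorem SameAtoms.sat {C : Type u} {M : ℕ} {ν ν' : ClockVal C} (h : SameAtoms M ν ν')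
    (g : ClockConstraint C) (hg : constraintMax g ≤ M) (hs : g.Sat ν) : g.Sat ν' := by
  induction g with
  | top => trivial
  | atom x r c => exact (h (.clock x r c) hg).1 hs
  | and g₁ g₂ ih₁ ih₂ =>
    exact ⟨ih₁ (le_trans (le_max_left _ _) hg) hs.1, ih₂ (le_trans (le_max_right _ _) hg) hs.2⟩

theorem SameAtoms.reset {C : Type u} {M : ℕ} {ν ν' : ClockVal C} (h : SameAtoms M ν ν')
    (r : Set C) : SameAtoms M (resetVal ν r) (resetVal ν' r) := by
  have hneg : ∀ (y : C) (s : Cmp) (c : ℤ), |c| ≤ M → s.Holds (0 - (ν y : ℝ)) c →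
      s.Holds (0 - (ν' y : ℝ)) c := by
    intro y s c hc hs
    have n1 := (ν y).2
    have n2 := (ν' y).2
    rcases le_or_gt c 0 with h0 | h0
    · obtain ⟨k, rfl⟩ : ∃ k : ℕ, c = -(k : ℤ) := ⟨c.natAbs, by omega⟩
      have hk : k ≤ M := by simpa using hc
      have e := fun s => h (.clock y s k) hk
      have e1 := (e .lt).1
      have e2 := (e .eq).1
      have e3 := (e .gt).1
      simp only [ZoneAtom.Sat, Cmp.Holds] at e1 e2 e3
      push_cast at hs ⊢
      rcases lt_trichotomy (ν y : ℝ) k with h | h | h <;> cases s <;> simp_all [Cmp.Holds] <;>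
        grind
    · have h1 : (0 : ℝ) < c := by exact_mod_cast h0
      have n1' : (0 : ℝ) ≤ ν y := n1
      have n2' : (0 : ℝ) ≤ ν' y := n2
      cases s <;> simp only [Cmp.Holds] at hs ⊢ <;> linarith
  have hpos : ∀ (x : C) (s : Cmp) (c : ℤ), |c| ≤ M → s.Holds ((ν x : ℝ) - 0) c →
      s.Holds ((ν' x : ℝ) - 0) c := by
    intro x s c hc hs
    have n1' : (0 : ℝ) ≤ ν x := (ν x).2
    have n2' : (0 : ℝ) ≤ ν' x := (ν' x).2
    rcases le_or_gt 0 c with h0 | h0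
    · obtain ⟨k, rfl⟩ : ∃ k : ℕ, c = (k : ℤ) := ⟨c.natAbs, by omega⟩
      have hk : k ≤ M := by simpa using hc
      have := (h (.clock x s k) hk).1
      simpa [ZoneAtom.Sat] using this (by simpa [ZoneAtom.Sat] using hs)
    · have h1 : (c : ℝ) < 0 := by exact_mod_cast h0
      cases s <;> simp only [Cmp.Holds] at hs ⊢ <;> linarith
  apply sameAtoms_of_imp
  rintro (⟨x, s, c⟩ | ⟨x, y, s, c⟩) hb hs
  · by_cases hx : x ∈ r
    · simpa [ZoneAtom.Sat, resetVal, hx] using hs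
    · have := (h _ hb).1
      simpa [ZoneAtom.Sat, resetVal, hx] using this (by simpa [ZoneAtom.Sat, resetVal, hx] using hs)
  · by_cases hx : x ∈ r <;> by_cases hy : y ∈ r <;>
      simp only [ZoneAtom.Sat, resetVal, hx, hy, if_true, if_false, NNReal.coe_zero] at hs ⊢
    · exact hs
    · exact hneg y s c hb hs
    · exact hpos x s c hb hs
    · exact (h _ hb).1 hs

/-- Transport of a cut along an isomorphism of finite linear preorders. -/
theorem exists_cut {ι : Type*} [Finite ι] (t t' : ι → ℝ) (h : ∀ i j, t i < t j → t' i < t' j)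
    (h' : ∀ i j, t i = t j → t' i = t' j) (d : ℝ) :
    ∃ d', ∀ i, (t i < d → t' i < d') ∧ (t i = d → t' i = d') ∧ (d < t i → d' < t' i) := by
  classical
  by_cases hd : ∃ k, t k = d
  · obtain ⟨k, rfl⟩ := hd
    exact ⟨t' k, fun i => ⟨h i k, h' i k, h k i⟩⟩
  · have := Fintype.ofFinite ι
    obtain ⟨m, h1, h2⟩ := Order.exists_between_finsets
      ((Finset.univ.filter fun i => t i < d).image t')
      ((Finset.univ.filter fun i => d < t i).image t') (by
        intro x hx y hy
        simp only [Finset.mem_image, Finset.mem_filter, Finset.mem_univ, true_and] at hx hy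
        obtain ⟨i, hi, rfl⟩ := hx
        obtain ⟨j, hj, rfl⟩ := hy
        exact h i j (hi.trans hj))
    refine ⟨m, fun i => ⟨fun hi => h1 _ ?_, fun hi => (hd ⟨i, hi⟩).elim, fun hi => h2 _ ?_⟩⟩
    · exact Finset.mem_image_of_mem _ (by simpa using hi)
    · exact Finset.mem_image_of_mem _ (by simpa using hi)

theorem SameAtoms.delay {C : Type u} [Finite C] {M : ℕ} {ν ν' : ClockVal C}
    (h : SameAtoms M ν ν') (d : ℝ≥0) :
    ∃ d' : ℝ≥0, SameAtoms M (fun x => ν x + d) (fun x => ν' x + d') := by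
  let t : ClockVal C → Option (C × Fin (M + 1)) → ℝ := fun μ k =>
    match k with
    | none => 0
    | some (x, c) => (c : ℕ) - μ x
  have habs : ∀ a b : Fin (M + 1), |((a : ℕ) : ℤ) - ((b : ℕ) : ℤ)| ≤ M := by
    intro a b
    rw [abs_le]
    omega
  have hc : ∀ (x : C) (a : Fin (M + 1)) (s : Cmp), s.Holds (ν x) (a : ℕ) →
      s.Holds (ν' x) (a : ℕ) := fun x a s =>
    (h (.clock x s a) (Nat.lt_succ_iff.1 a.2)).1
  have hd : ∀ (x y : C) (a b : Fin (M + 1)) (s : Cmp),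
      s.Holds ((ν x : ℝ) - ν y) ((a : ℕ) - (b : ℕ) : ℝ) →
      s.Holds ((ν' x : ℝ) - ν' y) ((a : ℕ) - (b : ℕ) : ℝ) := by
    intro x y a b s hs
    have := (h (.diag x y s (((a : ℕ) : ℤ) - ((b : ℕ) : ℤ))) (habs a b)).1
    simpa [ZoneAtom.Sat] using this (by simpa [ZoneAtom.Sat] using hs)
  obtain ⟨d', hd'⟩ := exists_cut (t ν) (t ν')
    (by
      rintro (_ | ⟨x, a⟩) (_ | ⟨y, b⟩) hlt <;> simp only [t] at hlt ⊢
      · exact absurd hlt (lt_irrefl _)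
      · have := hc y b .lt (by simp only [Cmp.Holds]; linarith)
        simp only [Cmp.Holds] at this; linarith
      · have := hc x a .gt (by simp only [Cmp.Holds]; linarith)
        simp only [Cmp.Holds] at this; linarith
      · have := hd x y a b .gt (by simp only [Cmp.Holds]; linarith)
        simp only [Cmp.Holds] at this; linarith)
    (by
      rintro (_ | ⟨x, a⟩) (_ | ⟨y, b⟩) hlt <;> simp only [t] at hlt ⊢
      · have := hc y b .eq (by simp only [Cmp.Holds]; linarith)
        simp only [Cmp.Holds] at this; linarith
      · have := hc x a .eq (by simp only [Cmp.Holds]; linarith)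
        simp only [Cmp.Holds] at this; linarith
      · have := hd x y a b .eq (by simp only [Cmp.Holds]; linarith)
        simp only [Cmp.Holds] at this; linarith) d
  have h0 : 0 ≤ d' := by
    obtain ⟨h1, h2, -⟩ := hd' none
    rcases d.2.lt_or_eq with h | h
    · exact (h1 h).le
    · exact (h2 h).le
  lift d' to ℝ≥0 using h0
  refine ⟨d', sameAtoms_of_imp ?_⟩
  rintro (⟨x, s, c⟩ | ⟨x, y, s, c⟩) hb hs
  · obtain ⟨h1, h2, h3⟩ := hd' (some (x, ⟨c, Nat.lt_succ_iff.2 hb⟩))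
    simp only [t] at h1 h2 h3
    simp only [ZoneAtom.Sat, NNReal.coe_add] at hs ⊢
    rcases lt_trichotomy ((c : ℝ) - ν x) d with h | h | h
    · have := h1 h
      cases s <;> simp only [Cmp.Holds] at hs ⊢ <;> linarith
    · have := h2 h
      cases s <;> simp only [Cmp.Holds] at hs ⊢ <;> linarith
    · have := h3 h
      cases s <;> simp only [Cmp.Holds] at hs ⊢ <;> linarith
  · have := (h _ hb).1
    simpa [ZoneAtom.Sat] using this (by simpa [ZoneAtom.Sat] using hs)

variable {L C Act : Type*}

theorem exists_constBound [Finite L] (A : TimedAutomaton L C Act) :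
    ∃ M, (∀ l, constraintMax (A.inv l) ≤ M) ∧ ∀ e ∈ A.edges, constraintMax e.guard ≤ M := by
  obtain ⟨M₁, h₁⟩ := (Set.finite_range fun l => constraintMax (A.inv l)).bddAbove
  obtain ⟨M₂, h₂⟩ := (A.edges_finite.image fun e => constraintMax e.guard).bddAbove
  exact ⟨max M₁ M₂, fun l => le_max_of_le_left (h₁ ⟨l, rfl⟩),
    fun e he => le_max_of_le_right (h₂ ⟨e, he, rfl⟩)⟩

theorem isTimeAbstractedBisimulation_sameAtoms [Finite C] (A : TimedAutomaton L C Act) {M : ℕ}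
    (hI : ∀ l, constraintMax (A.inv l) ≤ M) (hE : ∀ e ∈ A.edges, constraintMax e.guard ≤ M) :
    A.tlts.IsTimeAbstractedBisimulation fun q q' =>
      q.loc = q'.loc ∧ SameAtoms M q.val q'.val := by
  refine ⟨fun p q h => ⟨h.1.symm, h.2.symm⟩, ?_, ?_⟩
  · rintro p q ⟨hl, hv⟩ a p' ⟨e, he, h1, h2, h3, h4, h5⟩
    have hr := hv.reset e.reset
    rw [← h5] at hr
    refine ⟨⟨(p'.loc, resetVal q.val e.reset), hr.sat _ (hI _) p'.2⟩,
      ⟨e, he, h1.trans hl, h2, h3, hv.sat _ (hE e he) h4, rfl⟩, rfl, hr⟩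
  · rintro p q ⟨hl, hv⟩ d p' ⟨h1, h2⟩
    obtain ⟨d', hd⟩ := hv.delay d
    rw [← h2] at hd
    refine ⟨d', ⟨(p'.loc, fun x => q.val x + d'), hd.sat _ (hI _) p'.2⟩, ⟨h1.trans hl, rfl⟩,
      rfl, hd⟩

theorem convex_zoneAtom {C : Type*} (b : ZoneAtom C) : Convex ℝ≥0 {ν | b.Sat ν} := by
  intro ν hν μ hμ s t hs ht hst
  have hs' : (0 : ℝ) ≤ s := s.2
  have ht' : (0 : ℝ) ≤ t := t.2
  have hst' : (s : ℝ) + t = 1 := by exact_mod_cast hst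
  have key : ∀ (r : Cmp) (x y c : ℝ), r.Holds x c → r.Holds y c → r.Holds (s * x + t * y) c := by
    intro r x y c hx hy
    have e : c = s * c + t * c := by rw [← add_mul, hst', one_mul]
    rcases hs'.eq_or_lt with h0 | h0
    · have : (t : ℝ) = 1 := by linarith
      rw [← h0, this]
      simpa using hy
    · cases r <;> simp only [Cmp.Holds] at hx hy ⊢
      · nlinarith
      · nlinarith
      · rw [hx, hy]; exact e.symm
      · nlinarith
      · nlinarith
  cases b with
  | clock x r c => simpa [ZoneAtom.Sat] using key r _ _ _ hν hμ
  | diag x y r c =>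
    have := key r _ _ _ hν hμ
    simp only [Set.mem_ofPred_eq, ZoneAtom.Sat, Pi.add_apply, Pi.smul_apply, smul_eq_mul,
      NNReal.coe_add, NNReal.coe_mul]
    convert this using 1
    ring

/-- Every process of a timed automaton has a zone valuation graph. -/
theorem exists_isZoneValuationGraph [Finite L] [Finite C] (A : TimedAutomaton L C Act)
    (p : A.Proc) : ∃ (n : ℕ) (Z : ZoneGraph L C Act (Fin n)), A.IsZoneValuationGraph p Z := by
  classical
  obtain ⟨M, hI, hE⟩ := A.exists_constBound
  have hfin := finite_boundedAtoms C M
  let sig : A.Proc → L × Set (ZoneAtom C) := fun q => (q.loc, {b ∈ boundedAtoms C M | b.Sat q.val})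
  let R : Set (L × Set (ZoneAtom C)) := sig '' {q | A.tlts.Reachable p q}
  have hR : R.Finite := by
    refine ((Set.finite_univ (α := L)).prod hfin.finite_subsets).subset ?_
    rintro _ ⟨q, -, rfl⟩
    exact ⟨trivial, fun b hb => hb.1⟩
  have : Finite R := hR
  obtain ⟨n, ⟨e⟩⟩ := Finite.exists_equiv_fin R
  let zone : Fin n → L → Set (ClockVal C) := fun s l =>
    {ν | (e.symm s).1.1 = l ∧ ∀ b ∈ (e.symm s).1.2, b.Sat ν}
  let G : Fin n → Set A.Proc := fun s => {q | A.tlts.Reachable p q ∧ q.val ∈ zone s q.loc}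
  let node : ∀ q, A.tlts.Reachable p q → Fin n := fun q hq => e ⟨sig q, q, hq, rfl⟩
  have hnode : ∀ q hq, q ∈ G (node q hq) := by
    intro q hq
    refine ⟨hq, ?_, ?_⟩
    · simp [node, sig]
    · intro b hb
      simp only [node, sig, Equiv.symm_apply_apply] at hb
      exact hb.2
  have hsame : ∀ s, ∀ q ∈ G s, ∀ q' ∈ G s, q.loc = q'.loc ∧ SameAtoms M q.val q'.val := by
    intro s
    obtain ⟨r, hr, hrs⟩ := (e.symm s).2
    have h1 : ∀ q ∈ G s, r.loc = q.loc ∧ SameAtoms M r.val q.val := by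
      rintro q ⟨-, hq1, hq2⟩
      rw [← hrs] at hq1 hq2
      exact ⟨hq1, sameAtoms_of_imp fun b hb hs => hq2 b ⟨hb, hs⟩⟩
    intro q hq q' hq'
    exact ⟨(h1 q hq).1.symm.trans (h1 q' hq').1,
      fun b hb => ((h1 q hq).2 b hb).symm.trans ((h1 q' hq').2 b hb)⟩
  let Z : ZoneGraph L C Act (Fin n) :=
    { zone := zone
      init := node p .refl
      step := fun s α s' => ∃ q ∈ G s, ∃ q' ∈ G s', A.lepStep q α q' }
  refine ⟨n, Z, inferInstance, ?_, ?_, (hnode p .refl).2, fun q hq => ⟨node q hq, hnode q hq⟩,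
    fun s α s' => Iff.rfl, ?_, ?_⟩
  · intro s l
    have hs : (e.symm s).1.2 ⊆ boundedAtoms C M := by
      obtain ⟨r, hr, hrs⟩ := (e.symm s).2
      rw [← hrs]
      exact fun b hb => hb.1
    by_cases hl : (e.symm s).1.1 = l
    · refine ⟨[(hfin.subset hs).toFinset.toList], ?_⟩
      ext ν
      simp [Z, zone, hl]
    · refine ⟨[], ?_⟩
      ext ν
      simp [Z, zone, hl]
  · intro s l ν hν μ hμ a b ha hb hab
    exact ⟨hν.1, fun c hc => convex_zoneAtom c (hν.2 c hc) (hμ.2 c hc) ha hb hab⟩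
  · have hreach : ∀ q, A.tlts.Reachable p q → ∀ s, q ∈ G s →
        Relation.ReflTransGen (fun s s' => ∃ α, Z.step s α s') Z.init s := by
      intro q hq
      have step : ∀ r t s, A.tlts.Reachable p r → t ∈ G s →
          ((∃ a, A.tlts.act r a t) ∨ (∃ d, A.tlts.delay r d t)) →
          (∀ s, r ∈ G s → Relation.ReflTransGen (fun s s' => ∃ α, Z.step s α s') Z.init s) →
          Relation.ReflTransGen (fun s s' => ∃ α, Z.step s α s') Z.init s := by
        intro r t s hr ht hrt ih
        refine (ih _ (hnode r hr)).tail ?_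
        rcases hrt with ⟨a, ha⟩ | ⟨d, hd⟩
        · exact ⟨.act a, r, hnode r hr, t, ht, ha⟩
        · exact ⟨.eps, r, hnode r hr, t, ht, d, hd⟩
      induction hq with
      | refl =>
        intro s hs
        refine Relation.ReflTransGen.single ⟨.eps, p, hnode p .refl, p, hs, 0, rfl, ?_⟩
        funext x
        simp
      | tail hq hqr ih => exact fun s hs => step _ _ s hq hs hqr ih
    intro s
    obtain ⟨r, hr, hrs⟩ := (e.symm s).2
    have : node r hr = s := by
      have : (⟨sig r, r, hr, rfl⟩ : R) = e.symm s := Subtype.ext hrs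
      simp only [node]
      rw [this, Equiv.apply_symm_apply]
    exact hreach r hr s (this ▸ hnode r hr)
  · intro s q hq q' hq'
    exact ⟨_, A.isTimeAbstractedBisimulation_sameAtoms hI hE, hsame s q hq q' hq'⟩

end TimedAutomaton

/-! Call the class of a node the set of processes that are time abstracted bisimilar to some process
of the node. Processes and nodes simulate each other through these classes. If `x` is in the class
of `s`, each step of `x` projects to an edge out of `s` (`exists_step`), and each edge out of `s`
lifts to a step of `x` (`exists_lepStep`); both times the target process is in the class of the
target node. Classes are needed instead of `nodeProcs`: the lifted step is only known to end in a
process bisimilar to a member of the target node, not in a member. Since the invariant is restored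
after each step, both statements extend to labelled paths.

The defender wins exactly if there is a set of positions containing the start and closed under
suitable replies. Such a set induces the relation "`x` and `y` are in the classes of the two nodes
of some position of the set", and an observational bisimulation induces the set of positions whose
classes contain related processes. Projecting and lifting turn the closure property of one into that
of the other. The label `ε` fits this scheme because three delays in a row add up to one, and one
delay can be padded with zero delays. -/

/-! ### Time abstracted bisimilarity is an equivalence relation -/

namespace TLTS

variable {Act State : Type*} {T : TLTS Act State} {p q r : State}

theorem TimeAbstractedBisimilar.refl (T : TLTS Act State) (p : State) :
    T.TimeAbstractedBisimilar p p :=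
  ⟨Eq, ⟨fun _ _ h => h.symm, fun _ _ h _ p' hp => ⟨p', h ▸ hp, rfl⟩,
    fun _ _ h d p' hp => ⟨d, p', h ▸ hp, rfl⟩⟩, rfl⟩

theorem TimeAbstractedBisimilar.symm (h : T.TimeAbstractedBisimilar p q) :
    T.TimeAbstractedBisimilar q p := by
  obtain ⟨R, hR, hpq⟩ := h
  exact ⟨R, hR, hR.symm _ _ hpq⟩

theorem TimeAbstractedBisimilar.act (h : T.TimeAbstractedBisimilar p q) {a : Act} {p' : State}
    (hp : T.act p a p') : ∃ q', T.act q a q' ∧ T.TimeAbstractedBisimilar p' q' := by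
  obtain ⟨R, hR, hpq⟩ := h
  obtain ⟨q', hq, hr⟩ := hR.act _ _ hpq _ _ hp
  exact ⟨q', hq, R, hR, hr⟩

theorem TimeAbstractedBisimilar.delay (h : T.TimeAbstractedBisimilar p q) {d : ℝ≥0} {p' : State}
    (hp : T.delay p d p') : ∃ d' q', T.delay q d' q' ∧ T.TimeAbstractedBisimilar p' q' := by
  obtain ⟨R, hR, hpq⟩ := h
  obtain ⟨d', q', hq, hr⟩ := hR.delay _ _ hpq _ _ hp
  exact ⟨d', q', hq, R, hR, hr⟩

/-- Composing the two given witness relations need not give a symmetric relation. Composing the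
whole of bisimilarity with itself does. -/
theorem TimeAbstractedBisimilar.trans (h : T.TimeAbstractedBisimilar p q)
    (h' : T.TimeAbstractedBisimilar q r) : T.TimeAbstractedBisimilar p r := by
  refine ⟨fun x z => ∃ y, T.TimeAbstractedBisimilar x y ∧ T.TimeAbstractedBisimilar y z,
    ⟨?_, ?_, ?_⟩, q, h, h'⟩
  · rintro x z ⟨y, hxy, hyz⟩
    exact ⟨y, hyz.symm, hxy.symm⟩
  · rintro x z ⟨y, hxy, hyz⟩ a x' hx
    obtain ⟨y', hy, hxy'⟩ := hxy.act hx
    obtain ⟨z', hz, hyz'⟩ := hyz.act hy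
    exact ⟨z', hz, y', hxy', hyz'⟩
  · rintro x z ⟨y, hxy, hyz⟩ d x' hx
    obtain ⟨d', y', hy, hxy'⟩ := hxy.delay hx
    obtain ⟨d'', z', hz, hyz'⟩ := hyz.delay hy
    exact ⟨d'', z', hz, y', hxy', hyz'⟩

end TLTS

/-! ### Delays and steps with hidden durations -/

namespace TimedAutomaton

variable {L C Act N : Type*} {A : TimedAutomaton L C Act}

theorem delay_zero (x : A.Proc) : A.tlts.delay x 0 x :=
  ⟨rfl, by funext c; simp⟩

theorem delay_add {x y z : A.Proc} {d e : ℝ≥0} (hxy : A.tlts.delay x d y)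
    (hyz : A.tlts.delay y e z) : A.tlts.delay x (d + e) z :=
  ⟨hyz.1.trans hxy.1, by rw [hyz.2, hxy.2]; funext c; exact add_assoc _ _ _⟩

theorem lepStep_of_wordPath_eps {x x' : A.Proc}
    (h : WordPath A.lepStep [.eps, .eps, .eps] x x') : A.lepStep x .eps x' := by
  obtain ⟨x₁, ⟨d₁, h₁⟩, x₂, ⟨d₂, h₂⟩, x₃, ⟨d₃, h₃⟩, rfl⟩ := h
  exact ⟨_, delay_add (delay_add h₁ h₂) h₃⟩

theorem wordPath_of_lepStep_eps {x x' : A.Proc} (h : A.lepStep x .eps x') :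
    WordPath A.lepStep [.eps, .eps, .eps] x x' :=
  ⟨x, ⟨0, delay_zero x⟩, x', h, x', ⟨0, delay_zero x'⟩, rfl⟩

theorem _root_.TLTS.TimeAbstractedBisimilar.lepStep {x y x' : A.Proc} {α : Lep Act}
    (h : A.tlts.TimeAbstractedBisimilar x y) (hx : A.lepStep x α x') :
    ∃ y', A.lepStep y α y' ∧ A.tlts.TimeAbstractedBisimilar x' y' := by
  cases α with
  | eps =>
    obtain ⟨d, hd⟩ := hx
    obtain ⟨d', y', hy, h'⟩ := h.delay hd
    exact ⟨y', ⟨d', hy⟩, h'⟩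
  | act a => exact h.act hx

theorem reachable_lepStep {p x x' : A.Proc} {α : Lep Act} (h : A.tlts.Reachable p x)
    (hx : A.lepStep x α x') : A.tlts.Reachable p x' := by
  cases α with
  | eps => exact h.tail (.inr hx)
  | act a => exact h.tail (.inl ⟨a, hx⟩)

/-- The processes that are time abstracted bisimilar to some process of the node `s`. -/
def nodeClass (A : TimedAutomaton L C Act) (p : A.Proc) (Z : ZoneGraph L C Act N) (s : N) :
    Set A.Proc :=
  {x | ∃ y ∈ A.nodeProcs p Z s, A.tlts.TimeAbstractedBisimilar x y}

/-! ### Projecting steps to edges and lifting edges to steps -/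

namespace IsZoneValuationGraph

variable {p : A.Proc} {Z : ZoneGraph L C Act N}

theorem mem_nodeClass_init (hZ : A.IsZoneValuationGraph p Z) : p ∈ A.nodeClass p Z Z.init :=
  ⟨p, ⟨.refl, hZ.init_mem⟩, .refl _ p⟩

/-- The step of `x` is first copied by a member `y` of the node. The copy is reachable because `y`
is, so a node covers it; `x` itself need not be reachable. -/
theorem exists_step (hZ : A.IsZoneValuationGraph p Z) {s : N} {x x' : A.Proc} {α : Lep Act}
    (hx : x ∈ A.nodeClass p Z s) (h : A.lepStep x α x') :
    ∃ s', Z.step s α s' ∧ x' ∈ A.nodeClass p Z s' := by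
  obtain ⟨y, hy, hxy⟩ := hx
  obtain ⟨y', hyy', hxy'⟩ := hxy.lepStep h
  obtain ⟨s', hs'⟩ := hZ.cover y' (reachable_lepStep hy.1 hyy')
  exact ⟨s', (hZ.step_iff _ _ _).2 ⟨y, hy, y', hs', hyy'⟩, y', hs', hxy'⟩

/-- An edge promises a step for just one member `z` of the node. Bisimilarity of all members of a
node carries that step over to `x`. -/
theorem exists_lepStep (hZ : A.IsZoneValuationGraph p Z) {s s' : N} {x : A.Proc} {α : Lep Act}
    (hx : x ∈ A.nodeClass p Z s) (h : Z.step s α s') :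
    ∃ x', A.lepStep x α x' ∧ x' ∈ A.nodeClass p Z s' := by
  obtain ⟨y, hy, hxy⟩ := hx
  obtain ⟨z, hz, z', hz', hzz'⟩ := (hZ.step_iff _ _ _).1 h
  obtain ⟨x', hx', hzx'⟩ := (hxy.trans (hZ.bisimilar s y hy z hz)).symm.lepStep hzz'
  exact ⟨x', hx', z', hz', hzx'.symm⟩

theorem exists_wordPath (hZ : A.IsZoneValuationGraph p Z) {w : List (Lep Act)} {s : N}
    {x x' : A.Proc} (hx : x ∈ A.nodeClass p Z s) (h : WordPath A.lepStep w x x') :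
    ∃ s', WordPath Z.step w s s' ∧ x' ∈ A.nodeClass p Z s' := by
  induction w generalizing s x with
  | nil => exact ⟨s, rfl, h ▸ hx⟩
  | cons α w ih =>
    obtain ⟨y, hxy, hy⟩ := h
    obtain ⟨t, hst, ht⟩ := hZ.exists_step hx hxy
    obtain ⟨s', hs', hx'⟩ := ih ht hy
    exact ⟨s', ⟨t, hst, hs'⟩, hx'⟩

theorem exists_lepPath (hZ : A.IsZoneValuationGraph p Z) {w : List (Lep Act)} {s s' : N}
    {x : A.Proc} (hx : x ∈ A.nodeClass p Z s) (h : WordPath Z.step w s s') :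
    ∃ x', WordPath A.lepStep w x x' ∧ x' ∈ A.nodeClass p Z s' := by
  induction w generalizing s x with
  | nil => exact ⟨x, rfl, h ▸ hx⟩
  | cons α w ih =>
    obtain ⟨t, hst, ht⟩ := h
    obtain ⟨y, hxy, hy⟩ := hZ.exists_lepStep hx hst
    obtain ⟨x', hx', hs'⟩ := ih hy ht
    exact ⟨x', ⟨y, hxy, hx'⟩, hs'⟩

end IsZoneValuationGraph

end TimedAutomaton

open TimedAutomaton

/-! ### Observational bisimulations as matching along `ε, α, ε` -/

section Matching

variable {Act L₁ C₁ L₂ C₂ : Type*} {A₁ : TimedAutomaton L₁ C₁ Act} {A₂ : TimedAutomaton L₂ C₂ Act}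

namespace TLTS.IsTimeAbstractedObsBisimulation

variable {R : A₁.Proc ⊕ A₂.Proc → A₁.Proc ⊕ A₂.Proc → Prop}

theorem exists_right
    (hR : (A₁.tlts.sum A₂.tlts).IsTimeAbstractedObsBisimulation R)
    {x x' : A₁.Proc} {y : A₂.Proc} {α : Lep Act} (h : R (.inl x) (.inr y))
    (hx : A₁.lepStep x α x') :
    ∃ y', WordPath A₂.lepStep [.eps, α, .eps] y y' ∧ R (.inl x') (.inr y') := by
  cases α with
  | eps =>
    obtain ⟨d, hd⟩ := hx
    obtain ⟨d', _ | y', hy, h'⟩ := hR.delay _ _ h d (.inl x') hd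
    · exact hy.elim
    · exact ⟨y', wordPath_of_lepStep_eps ⟨d', hy⟩, h'⟩
  | act a =>
    -- Transitions of the disjoint union stay in their summand, so every case with a state of the
    -- left summand is contradictory.
    obtain ⟨d₁, _ | y₁, _ | y₂, d₂, _ | y', h₁, h₂, h₃, h'⟩ := hR.act _ _ h a (.inl x') hx <;>
      try first | exact h₁.elim | exact h₂.elim | exact h₃.elim
    exact ⟨y', ⟨y₁, ⟨d₁, h₁⟩, y₂, h₂, y', ⟨d₂, h₃⟩, rfl⟩, h'⟩

theorem exists_left
    (hR : (A₁.tlts.sum A₂.tlts).IsTimeAbstractedObsBisimulation R)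
    {x : A₁.Proc} {y y' : A₂.Proc} {α : Lep Act} (h : R (.inl x) (.inr y))
    (hy : A₂.lepStep y α y') :
    ∃ x', WordPath A₁.lepStep [.eps, α, .eps] x x' ∧ R (.inl x') (.inr y') := by
  replace h := hR.symm _ _ h
  cases α with
  | eps =>
    obtain ⟨d, hd⟩ := hy
    obtain ⟨d', x' | _, hx, h'⟩ := hR.delay _ _ h d (.inr y') hd
    · exact ⟨x', wordPath_of_lepStep_eps ⟨d', hx⟩, hR.symm _ _ h'⟩
    · exact hx.elim
  | act a =>
    obtain ⟨d₁, x₁ | _, x₂ | _, d₂, x' | _, h₁, h₂, h₃, h'⟩ := hR.act _ _ h a (.inr y') hy <;>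
      try first | exact h₁.elim | exact h₂.elim | exact h₃.elim
    exact ⟨x', ⟨x₁, ⟨d₁, h₁⟩, x₂, h₂, x', ⟨d₂, h₃⟩, rfl⟩, hR.symm _ _ h'⟩

end TLTS.IsTimeAbstractedObsBisimulation

/-- A relation between two automata whose steps are matched along `ε, α, ε` yields observational
bisimilarity. -/
theorem timeAbstractedObsBisimilar_of_match (R : A₁.Proc → A₂.Proc → Prop)
    (hr : ∀ x y α x', R x y → A₁.lepStep x α x' →
      ∃ y', WordPath A₂.lepStep [.eps, α, .eps] y y' ∧ R x' y')
    (hl : ∀ x y α y', R x y → A₂.lepStep y α y' →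
      ∃ x', WordPath A₁.lepStep [.eps, α, .eps] x x' ∧ R x' y')
    {p : A₁.Proc} {q : A₂.Proc} (h : R p q) : TimeAbstractedObsBisimilar p q := by
  -- The symmetric version of `R` on the disjoint union, relating no two states of the same summand.
  let S : A₁.Proc ⊕ A₂.Proc → A₁.Proc ⊕ A₂.Proc → Prop
    | .inl x, .inr y => R x y
    | .inr y, .inl x => R x y
    | _, _ => False
  refine ⟨S, ⟨?_, ?_, ?_⟩, h⟩
  · rintro (x | y) (x' | y') h <;> exact h
  · rintro (x | y) (u | v) h a (x' | y') hs <;> first | exact h.elim | exact hs.elim | skip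
    · obtain ⟨v', ⟨v₁, ⟨d₁, h₁⟩, v₂, h₂, v₃, ⟨d₂, h₃⟩, rfl⟩, h'⟩ := hr x v (.act a) x' h hs
      exact ⟨d₁, .inr v₁, .inr v₂, d₂, .inr v₃, h₁, h₂, h₃, h'⟩
    · obtain ⟨u', ⟨u₁, ⟨d₁, h₁⟩, u₂, h₂, u₃, ⟨d₂, h₃⟩, rfl⟩, h'⟩ := hl u y (.act a) y' h hs
      exact ⟨d₁, .inl u₁, .inl u₂, d₂, .inl u₃, h₁, h₂, h₃, h'⟩
  · rintro (x | y) (u | v) h d (x' | y') hs <;> first | exact h.elim | exact hs.elim | skip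
    · obtain ⟨v', hv, h'⟩ := hr x v .eps x' h ⟨d, hs⟩
      obtain ⟨d', hd'⟩ := lepStep_of_wordPath_eps hv
      exact ⟨d', .inr v', hd', h'⟩
    · obtain ⟨u', hu, h'⟩ := hl u y .eps y' h ⟨d, hs⟩
      obtain ⟨d', hd'⟩ := lepStep_of_wordPath_eps hu
      exact ⟨d', .inl u', hd', h'⟩

end Matching

/-! ### Winning strategies and invariants of positions -/

/-- The defender wins if an invariant of positions can be maintained by legal replies. -/
theorem BisimGame.defenderWins_of_invariant {Lab S₁ S₂ : Type*} (Γ : BisimGame Lab S₁ S₂)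
    (I : S₁ × S₂ → Prop) (hstart : I Γ.start)
    (hI : ∀ x c, I x → Γ.LegalChallenge x c → ∃ y, Γ.LegalReply x c y ∧ I y) :
    Γ.DefenderWins := by
  classical
  -- A memoryless strategy. The default `x` never occurs when a legal challenge is made at a
  -- position satisfying `I`.
  let σ : BisimGame.Strategy Lab S₁ S₂ := fun _ x c =>
    if h : ∃ y, Γ.LegalReply x c y ∧ I y then h.choose else x
  have hσ : ∀ h x c, I x → Γ.LegalChallenge x c → Γ.LegalReply x c (σ h x c) ∧ I (σ h x c) := by
    intro h x c hx hc
    have hy := hI x c hx hc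
    simp only [σ, dif_pos hy]
    exact hy.choose_spec
  have hinv : ∀ h x, Γ.Consistent σ h x → I x := by
    intro h x hx
    induction hx with
    | start => exact hstart
    | round h x c _ hc ih => exact (hσ h x c ih hc).2
  exact ⟨σ, fun h x c hx hc => (hσ h x c (hinv h x hx) hc).1⟩

/-- The positions that a winning strategy can reach form an invariant. -/
theorem BisimGame.DefenderWins.exists_invariant {Lab S₁ S₂ : Type*} {Γ : BisimGame Lab S₁ S₂}
    (h : Γ.DefenderWins) : ∃ I : S₁ × S₂ → Prop, I Γ.start ∧
      ∀ x c, I x → Γ.LegalChallenge x c → ∃ y, Γ.LegalReply x c y ∧ I y := by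
  obtain ⟨σ, hσ⟩ := h
  -- The reply of `σ` may depend on the history, but any history leading to `x` will do, as only the
  -- existence of a reply is asked for.
  refine ⟨fun x => ∃ h, Γ.Consistent σ h x, ⟨[], .start⟩, ?_⟩
  rintro x c ⟨h, hx⟩ hc
  exact ⟨σ h x c, hσ h x c hx hc, _, .round h x c hx hc⟩

/-! ### The equivalence of game and bisimilarity -/

theorem mainTheorem8 {Act L₁ C₁ N₁ L₂ C₂ N₂ : Type*} [Finite Act]
    [Finite L₁] [Finite C₁] [Finite L₂] [Finite C₂]
    (A₁ : TimedAutomaton L₁ C₁ Act) (A₂ : TimedAutomaton L₂ C₂ Act)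
    (p : A₁.Proc) (q : A₂.Proc)
    (Z₁ : ZoneGraph L₁ C₁ Act N₁) (Z₂ : ZoneGraph L₂ C₂ Act N₂)
    (hZ₁ : A₁.IsZoneValuationGraph p Z₁) (hZ₂ : A₂.IsZoneValuationGraph q Z₂) :
    (obsGame Z₁ Z₂).DefenderWins ↔ TimeAbstractedObsBisimilar p q := by
  constructor
  · intro h
    obtain ⟨I, hstart, hI⟩ := h.exists_invariant
    refine timeAbstractedObsBisimilar_of_match
      (fun x y => ∃ s t, I (s, t) ∧ x ∈ A₁.nodeClass p Z₁ s ∧ y ∈ A₂.nodeClass q Z₂ t) ?_ ?_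
      ⟨_, _, hstart, hZ₁.mem_nodeClass_init, hZ₂.mem_nodeClass_init⟩
    -- The step of `x` is projected to an edge and played as a challenge; the reply path is lifted
    -- to a path of processes from `y`.
    · rintro x y α x' ⟨s, t, hst, hx, hy⟩ hxx'
      obtain ⟨s', hs, hx'⟩ := hZ₁.exists_step hx hxx'
      obtain ⟨⟨_, t'⟩, ⟨rfl, ht⟩, hI'⟩ := hI (s, t) (.left α s') hst ⟨s', hs, rfl⟩
      obtain ⟨y', hyy', hy'⟩ := hZ₂.exists_lepPath hy ht
      exact ⟨y', hyy', _, t', hI', hx', hy'⟩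
    · rintro x y α y' ⟨s, t, hst, hx, hy⟩ hyy'
      obtain ⟨t', ht, hy'⟩ := hZ₂.exists_step hy hyy'
      obtain ⟨⟨s', _⟩, ⟨rfl, hs⟩, hI'⟩ := hI (s, t) (.right α t') hst ⟨t', ht, rfl⟩
      obtain ⟨x', hxx', hx'⟩ := hZ₁.exists_lepPath hx hs
      exact ⟨x', hxx', s', _, hI', hx', hy'⟩
  · rintro ⟨R, hR, hpq⟩
    refine BisimGame.defenderWins_of_invariant _
      (fun u => ∃ x y, R (.inl x) (.inr y) ∧ x ∈ A₁.nodeClass p Z₁ u.1 ∧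
        y ∈ A₂.nodeClass q Z₂ u.2)
      ⟨p, q, hpq, hZ₁.mem_nodeClass_init, hZ₂.mem_nodeClass_init⟩ ?_
    -- The attacker's word has one letter, so a challenge is a single edge `hstep`. It is lifted to
    -- a step of a process, answered by means of `R`, and the answer is projected to the other
    -- graph.
    rintro ⟨s, t⟩ (⟨α, s'⟩ | ⟨α, t'⟩) ⟨x, y, hxy, hx, hy⟩ ⟨_, hstep, rfl⟩
    · obtain ⟨x', hxx', hx'⟩ := hZ₁.exists_lepStep hx hstep
      obtain ⟨y', hyy', hxy'⟩ := hR.exists_right hxy hxx'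
      obtain ⟨t', ht, hy'⟩ := hZ₂.exists_wordPath hy hyy'
      exact ⟨(_, t'), ⟨rfl, ht⟩, x', y', hxy', hx', hy'⟩
    · obtain ⟨y', hyy', hy'⟩ := hZ₂.exists_lepStep hy hstep
      obtain ⟨x', hxx', hxy'⟩ := hR.exists_left hxy hyy'
      obtain ⟨s', hs, hx'⟩ := hZ₁.exists_wordPath hx hxx'
      exact ⟨(s', _), ⟨rfl, hs⟩, x', y', hxy', hx', hy'⟩
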